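/- Corollary (Hardy's uncertainty principle for the two-sided quaternion Fourier transform). For $f\in L^1(\mathbb R^2,\mathbb H)$ let $$\mathcal F\{f\}(y)=\int_{\mathbb R^2} e^{-2\pi \mathbf i\, y_1x_1}\,f(x)\,e^{-2\pi \mathbf j\, y_2x_2}\,dx,\qquad y\in\mathbb R^2,$$ where $\mathbf i,\mathbf j$ are the usual quaternion units, and let $|\cdot|$ denote the Euclidean norm on $\mathbb R^2$ and the modulus on $\mathbb H$. Let $\alpha,\beta>0$, and for $f\in L^1(\mathbb R^2,\mathbb H)$ consider the conditions (i) $|f(x)|<C\,e^{-\alpha|x|^2}$ for almost every $x\in\mathbb R^2$, for some constant $C>0$; (ii) $|\mathcal F\{f\}(y)|<C'\,e^{-\beta|y|^2}$ for all $y\in\mathbb R^2$, for some constant $C'>0$. Then: 1. If $\alpha\beta>\pi^2$, every $f\in L^1(\mathbb R^2,\mathbb H)$ satisfying (i) and (ii) vanishes almost everywhere. 2. If $\alpha\beta=\pi^2$, every $f\in L^1(\mathbb R^2,\mathbb H)$ satisfying (i) and (ii) is a constant quaternion multiple of a Gaussian: there is $q\in\mathbb H$ with $f(x)=q\,e^{-\alpha|x|^2}$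 for almost every $x$. 3. If $\alpha\beta<\pi^2$, there is an infinite sequence of functions $g_0,g_1,g_2,\dots$ in $L^1(\mathbb R^2,\mathbb H)$, each satisfying (i) at every $x\in\mathbb R^2$ and (ii) (with constants that may depend on the function), whose classes in $L^1(\mathbb R^2,\mathbb H)$ are linearly independent over $\mathbb H$, both for left and for right multiplication by scalars. -/

import Mathlib

open MeasureTheory
open scoped Quaternion

noncomputable section

/-- The quaternion unit `i`. -/
def quatI : ℍ[ℝ] := ⟨0, 1, 0, 0⟩

/-- The quaternion unit `j`. -/
def quatJ : ℍ[ℝ] := ⟨0, 0, 1, 0⟩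

/-- The two-sided quaternion Fourier transform
`F{f}(ξ) = ∫ e^{-i 2π ξ₁ x₁} f(x) e^{-j 2π ξ₂ x₂} dx` of `f : ℝ² → ℍ`. -/
def qft (f : EuclideanSpace ℝ (Fin 2) → ℍ[ℝ]) (ξ : EuclideanSpace ℝ (Fin 2)) : ℍ[ℝ] :=
  ∫ x : EuclideanSpace ℝ (Fin 2),
    NormedSpace.exp (-(2 * Real.pi * ξ 0 * x 0) • quatI) * f x *
      NormedSpace.exp (-(2 * Real.pi * ξ 1 * x 1) • quatJ)

end

/-!
Hardy's uncertainty principle for the two-sided quaternion Fourier transform is reduced to the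
complex one. The commuting maps `q ↦ i q` and `q ↦ q j` have square `-1`, so `q ↦ i q j` is an
involution and `ℍ` is the orthogonal sum of its eigenplanes `ℂ (1 + k)` and `ℂ (1 - k)`. On each of
them right multiplication by `j` is left multiplication by `-i` or `i`, which turns the transform
into an ordinary complex Fourier transform, up to the reflection `(y₁, y₂) ↦ (y₁, -y₂)` of the
frequency on the first plane (`splitPlus_qft`, `splitMinus_qft`). Both decay conditions pass to the
two coordinates.

For a complex-valued `h` with `|h(x)| ≤ C exp (-α |x|²)` and `αβ = π²`, the Fourier transform extends
along each line `ℝ y` to an entire function of one variable `w`, bounded by a multiple of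
`exp (β |y|² (Im w)²)`. Multiplied by `exp (β |y|² w²)` it is bounded on the real axis and grows at
most like `exp (β |y|² (Re w)²)`; by Phragmén–Lindelöf in sectors of opening less than `π / 2` and by
Liouville's theorem it is constant (`apply_eq_apply_zero_of_gaussian_growth`). So the Fourier
transform of `h` is a multiple of `exp (-β |y|²)`, and injectivity of the transform on `L¹` makes `h`
a multiple of `exp (-α |x|²)` (`exists_ae_eq_gaussian_of_fourier_decay`).

If `αβ > π²`, the critical case with `π² / β` in place of `α` gives a multiple of a Gaussian that
decays too slowly, unless it is zero. If `αβ < π²`, every Gaussian `exp (-γ |x|²)` with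
`α ≤ γ ≤ π² / β` satisfies both conditions, and Gaussians with distinct `γ` are linearly independent
by Dedekind's theorem on characters (`linearIndependent_toL1_quatGaussian`).
-/

/-! ### Entire functions of Gaussian growth -/

section Entire

open Complex Filter Topology Set

/-- The Phragmén–Lindelöf step in the sector `0 ≤ arg z ≤ θ < π / 2`, in the logarithmic coordinate
`z = exp ζ`. The factor `exp (i δ z²)` has modulus one on the positive real axis, and its constant
`δ = b cos θ / (2 sin θ)` makes it cancel the growth of `G` on the ray `arg z = θ`. -/
theorem norm_mul_exp_le_of_sector {G : ℂ → ℂ} (hG : Differentiable ℂ G) {b C M : ℝ} (hb : 0 ≤ b)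
    (hC : 0 ≤ C) (hCM : C ≤ M) (hgrowth : ∀ z, ‖G z‖ ≤ C * Real.exp (b * z.re ^ 2))
    (hreal : ∀ x : ℝ, ‖G x‖ ≤ M) {θ : ℝ} (hθ0 : 0 < θ) (hθ : θ < Real.pi / 2)
    {ζ : ℂ} (h0 : 0 ≤ ζ.im) (h1 : ζ.im ≤ θ) :
    ‖G (exp ζ)‖ ≤ M * Real.exp (b * Real.cos θ / (2 * Real.sin θ) *
      (Real.exp (2 * ζ.re) * Real.sin (2 * ζ.im))) := by
  set δ : ℝ := b * Real.cos θ / (2 * Real.sin θ) with hδ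
  have hsin : 0 < Real.sin θ := Real.sin_pos_of_pos_of_lt_pi hθ0 (by linarith [Real.pi_pos])
  have hcos : 0 < Real.cos θ := Real.cos_pos_of_mem_Ioo ⟨by linarith, hθ⟩
  have hδ0 : 0 ≤ δ := by positivity
  have hnorm (w : ℂ) : ‖exp (I * δ * exp (2 * w))‖ =
      Real.exp (-(δ * (Real.exp (2 * w.re) * Real.sin (2 * w.im)))) := by
    rw [Complex.norm_exp]
    congr 1
    simp [Complex.exp_re, Complex.exp_im, mul_assoc]
  have hre (w : ℂ) : (exp w).re ^ 2 = Real.exp (2 * w.re) * Real.cos w.im ^ 2 := by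
    rw [Complex.exp_re, mul_pow, ← Real.exp_nat_mul]
    norm_num
  let F : ℂ → ℂ := fun w => G (exp w) * exp (I * δ * exp (2 * w))
  have hFd : Differentiable ℂ F := by
    have : Differentiable ℂ fun w : ℂ => G (exp w) := hG.comp Complex.differentiable_exp
    exact this.mul (by fun_prop)
  have hF : ‖F ζ‖ ≤ M := by
    refine PhragmenLindelof.horizontal_strip (a := 0) (b := θ) hFd.diffContOnCl
      ⟨2, ?_, b + δ, ?_⟩ ?_ ?_ h0 h1
    · rw [lt_div_iff₀ (by linarith)]
      linarith
    · refine Asymptotics.IsBigO.of_bound C (Eventually.of_forall fun w => ?_)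
      have hw : Real.exp (2 * w.re) ≤ Real.exp (2 * |w.re|) :=
        Real.exp_le_exp.2 (by linarith [le_abs_self w.re])
      have hg := hgrowth (exp w)
      rw [norm_mul, hnorm, Real.norm_of_nonneg (Real.exp_nonneg _)]
      calc _ ≤ C * Real.exp (b * (exp w).re ^ 2) *
            Real.exp (-(δ * (Real.exp (2 * w.re) * Real.sin (2 * w.im)))) := by gcongr
        _ = C * Real.exp (b * (exp w).re ^ 2 +
            -(δ * (Real.exp (2 * w.re) * Real.sin (2 * w.im)))) := by
          rw [mul_assoc, ← Real.exp_add]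
        _ ≤ _ := by
          gcongr
          rw [add_mul]
          gcongr
          · rw [hre]
            calc _ ≤ Real.exp (2 * w.re) * 1 := by gcongr; exact Real.cos_sq_le_one _
              _ ≤ _ := by linarith
          · rw [← mul_neg]
            gcongr
            rw [← mul_neg]
            calc _ ≤ Real.exp (2 * w.re) * 1 := by
                  gcongr; linarith [Real.neg_one_le_sin (2 * w.im)]
              _ ≤ _ := by linarith
    · intro w hw
      have : exp w = (Real.exp w.re : ℂ) := by
        rw [Complex.ofReal_exp]
        congr 1
        apply Complex.ext <;> simp [hw]
      rw [norm_mul, hnorm, this, hw]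
      simpa using hreal (Real.exp w.re)
    · intro w hw
      rw [norm_mul, hnorm]
      calc _ ≤ C * Real.exp (b * (exp w).re ^ 2) *
            Real.exp (-(δ * (Real.exp (2 * w.re) * Real.sin (2 * w.im)))) := by
            gcongr; exact hgrowth _
        _ = C := by
          rw [mul_assoc, ← Real.exp_add, hre, hw, Real.sin_two_mul, hδ]
          have : b * (Real.exp (2 * w.re) * Real.cos θ ^ 2) + -(b * Real.cos θ / (2 * Real.sin θ) *
            (Real.exp (2 * w.re) * (2 * Real.sin θ * Real.cos θ))) = 0 := by
            field_simp
            ring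
          rw [this]
          simp
        _ ≤ M := hCM
  rw [norm_mul, hnorm, Real.exp_neg, ← div_eq_mul_inv, div_le_iff₀ (Real.exp_pos _)] at hF
  exact hF

/-- Let the opening `θ` of the sectors tend to `π / 2`. -/
theorem norm_le_of_first_quadrant {G : ℂ → ℂ} (hG : Differentiable ℂ G) {b C M : ℝ} (hb : 0 ≤ b)
    (hC : 0 ≤ C) (hCM : C ≤ M) (hgrowth : ∀ z, ‖G z‖ ≤ C * Real.exp (b * z.re ^ 2))
    (hreal : ∀ x : ℝ, ‖G x‖ ≤ M) {z : ℂ} (hre : 0 ≤ z.re) (him : 0 ≤ z.im) : ‖G z‖ ≤ M := by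
  rcases hre.eq_or_lt with hre | hre
  · refine (hgrowth z).trans ?_
    simpa [← hre] using hCM
  have hz : z ≠ 0 := fun h => by simp [h] at hre
  have harg0 : 0 ≤ z.arg := Complex.arg_nonneg_iff.2 him
  have harg1 : z.arg < Real.pi / 2 :=
    (abs_lt.1 (Complex.abs_arg_lt_pi_div_two_iff.2 (Or.inl hre))).2
  have hlim : Tendsto (fun θ : ℝ => M * Real.exp (b * Real.cos θ / (2 * Real.sin θ) *
      (Real.exp (2 * (log z).re) * Real.sin (2 * (log z).im)))) (𝓝[<] (Real.pi / 2)) (𝓝 M) := by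
    have : ContinuousAt (fun θ : ℝ => M * Real.exp (b * Real.cos θ / (2 * Real.sin θ) *
      (Real.exp (2 * (log z).re) * Real.sin (2 * (log z).im)))) (Real.pi / 2) := by
      refine continuousAt_const.mul (Real.continuous_exp.continuousAt.comp
        (ContinuousAt.mul (ContinuousAt.div ?_ ?_ ?_) continuousAt_const))
      · fun_prop
      · fun_prop
      · simp
    have h := this.tendsto.mono_left (nhdsWithin_le_nhds (s := Iio (Real.pi / 2)))
    simpa using h
  refine ge_of_tendsto hlim ?_
  filter_upwards [Ioo_mem_nhdsLT harg1] with θ hθ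
  have := norm_mul_exp_le_of_sector hG hb hC hCM hgrowth hreal (harg0.trans_lt hθ.1) hθ.2
    (ζ := log z) (by simpa [Complex.log_im] using him) (by simpa [Complex.log_im] using hθ.1.le)
  rwa [Complex.exp_log hz] at this

/-- The one-variable form of Hardy's theorem: an entire function that is bounded on the real axis
and is `O(exp (b (Re z)²))` is constant. It is bounded on each quadrant, the four of them being
interchanged by `z ↦ -z` and conjugation, so that Liouville's theorem applies. -/
theorem apply_eq_apply_zero_of_gaussian_growth {G : ℂ → ℂ} (hG : Differentiable ℂ G) {b C M : ℝ}
    (hb : 0 ≤ b) (hgrowth : ∀ z, ‖G z‖ ≤ C * Real.exp (b * z.re ^ 2))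
    (hreal : ∀ x : ℝ, ‖G x‖ ≤ M) (z : ℂ) : G z = G 0 := by
  have hC : 0 ≤ C := by simpa using (norm_nonneg _).trans (hgrowth 0)
  have hr (x : ℝ) : ‖G x‖ ≤ max C M := (hreal x).trans (le_max_right _ _)
  have key {H : ℂ → ℂ} (hH : Differentiable ℂ H)
      (hg : ∀ z, ‖H z‖ ≤ C * Real.exp (b * z.re ^ 2)) (hr : ∀ x : ℝ, ‖H x‖ ≤ max C M) {z : ℂ}
      (hz : 0 ≤ z.im) : ‖H z‖ ≤ max C M := by
    rcases le_total 0 z.re with h | h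
    · exact norm_le_of_first_quadrant hH hb hC (le_max_left _ _) hg hr h hz
    · have hd : Differentiable ℂ fun w => star (H (-star w)) :=
        fun w => by
          have := DifferentiableAt.star_star (f := fun w => H (-w)) (z := star w)
            (hH.comp differentiable_neg).differentiableAt
          rwa [star_star] at this
      have := norm_le_of_first_quadrant (G := fun w => star (H (-star w))) hd hb hC
        (le_max_left C M) (fun w => by simpa using hg (-star w))
        (fun x => by simpa using hr (-x)) (z := -star z) (by simpa using h) (by simpa using hz)
      simpa using this
  refine hG.apply_eq_apply_of_bounded (isBounded_iff_forall_norm_le.2 ⟨max C M, ?_⟩) z 0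
  rintro _ ⟨w, rfl⟩
  rcases le_total 0 w.im with h | h
  · exact key hG hgrowth hr h
  · simpa using key (H := fun w => G (-w)) (by fun_prop) (fun z => by simpa using hgrowth (-z))
      (fun x => by simpa using hr (-x)) (z := -w) (by simpa using h)

end Entire

/-! ### Hardy's theorem for complex-valued functions -/

section ComplexHardy

open Complex Filter Topology FourierTransform RealInnerProductSpace

variable {V : Type*} [NormedAddCommGroup V] [InnerProductSpace ℝ V] [FiniteDimensional ℝ V]
  [MeasurableSpace V] [BorelSpace V]

theorem integrable_rexp_neg_mul_sq_norm_add {a : ℝ} (ha : 0 < a) (c : ℝ) (y : V) :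
    Integrable fun x : V => Real.exp (-a * ‖x‖ ^ 2 + c * ⟪y, x⟫) := by
  have h := (GaussianFourier.integrable_cexp_neg_mul_sq_norm_add (V := V) (b := (a : ℂ))
    (by simpa using ha) c y).re
  refine h.congr (Eventually.of_forall fun x => ?_)
  have : (-(a : ℂ) * ‖x‖ ^ 2 + c * (⟪y, x⟫ : ℝ)) = ((-a * ‖x‖ ^ 2 + c * ⟪y, x⟫ : ℝ) : ℂ) := by
    push_cast; ring
  simp only [this, ← Complex.ofReal_exp]
  exact Complex.ofReal_re _

theorem integral_rexp_neg_mul_sq_norm_add {a : ℝ} (ha : 0 < a) (c : ℝ) (y : V) :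
    ∫ x : V, Real.exp (-a * ‖x‖ ^ 2 + c * ⟪y, x⟫) =
      (Real.pi / a) ^ (Module.finrank ℝ V / 2 : ℝ) * Real.exp (c ^ 2 * ‖y‖ ^ 2 / (4 * a)) := by
  have h := GaussianFourier.integral_cexp_neg_mul_sq_norm_add (V := V) (b := (a : ℂ))
    (by simpa using ha) c y
  rw [← Complex.ofReal_inj, ← integral_complex_ofReal]
  rw [Complex.ofReal_mul, Complex.ofReal_cpow (by positivity)]
  push_cast
  exact h

/-- For a function of Gaussian decay, the Fourier integral along a line, extended to complex
frequencies, is an entire function. -/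
theorem differentiable_integral_mul_cexp {h : V → ℂ} (hi : Integrable h) {a C : ℝ} (ha : 0 < a)
    (hC : ∀ᵐ x : V, ‖h x‖ ≤ C * Real.exp (-a * ‖x‖ ^ 2)) (y : V) :
    Differentiable ℂ fun w : ℂ => ∫ x : V, h x * cexp (w * (⟪y, x⟫ : ℝ)) := by
  intro w₀
  set R : ℝ := ‖w₀‖ + 1 with hR
  have hR0 : 0 ≤ R := by positivity
  have hw {w : ℂ} (hw : w ∈ Metric.ball w₀ 1) : |w.re| ≤ R := by
    refine (Complex.abs_re_le_norm w).trans ?_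
    have := norm_sub_norm_le w w₀
    rw [Metric.mem_ball, dist_eq_norm] at hw
    linarith
  have hexp (t : ℝ) : Real.exp |t| ≤ Real.exp t + Real.exp (-t) := by
    rcases abs_choice t with h | h <;> rw [h] <;> linarith [Real.exp_pos t, Real.exp_pos (-t)]
  have hbd {w : ℂ} (hmem : w ∈ Metric.ball w₀ 1) (t : ℝ) : ‖cexp (w * t)‖ ≤ Real.exp (R * |t|) := by
    rw [Complex.norm_exp]
    refine Real.exp_le_exp.2 ?_
    calc (w * t).re = w.re * t := by simp
      _ ≤ |w.re| * |t| := by rw [← abs_mul]; exact le_abs_self _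
      _ ≤ R * |t| := by gcongr; exact hw hmem
  -- `R + 1` instead of `R` absorbs the factor `⟪y, x⟫` of the derivative in `w`
  let bound : V → ℝ := fun x => C * (Real.exp (-a * ‖x‖ ^ 2 + (R + 1) * ⟪y, x⟫) +
    Real.exp (-a * ‖x‖ ^ 2 + (-(R + 1)) * ⟪y, x⟫))
  have hbound : Integrable bound :=
    ((integrable_rexp_neg_mul_sq_norm_add ha _ y).add
      (integrable_rexp_neg_mul_sq_norm_add ha _ y)).const_mul C
  have hle {x : V} (hx : ‖h x‖ ≤ C * Real.exp (-a * ‖x‖ ^ 2)) :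
      ‖h x‖ * Real.exp ((R + 1) * |⟪y, x⟫|) ≤ bound x := by
    have h1 : Real.exp ((R + 1) * |⟪y, x⟫|) ≤
        Real.exp ((R + 1) * ⟪y, x⟫) + Real.exp (-(R + 1) * ⟪y, x⟫) := by
      have := hexp ((R + 1) * ⟪y, x⟫)
      rwa [abs_mul, abs_of_nonneg (by positivity : 0 ≤ R + 1), ← neg_mul] at this
    calc _ ≤ C * Real.exp (-a * ‖x‖ ^ 2) *
          (Real.exp ((R + 1) * ⟪y, x⟫) + Real.exp (-(R + 1) * ⟪y, x⟫)) := by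
          gcongr
          exact (norm_nonneg _).trans hx
      _ = bound x := by simp only [bound, Real.exp_add]; ring
  have hmeas (w : ℂ) : AEStronglyMeasurable (fun x : V => h x * cexp (w * (⟪y, x⟫ : ℝ))) volume :=
    hi.aestronglyMeasurable.mul (by fun_prop)
  have hself : w₀ ∈ Metric.ball w₀ 1 := Metric.mem_ball_self one_pos
  refine (hasDerivAt_integral_of_dominated_loc_of_deriv_le (bound := bound)
    (F := fun (w : ℂ) (x : V) => h x * cexp (w * (⟪y, x⟫ : ℝ)))
    (F' := fun (w : ℂ) (x : V) => h x * (cexp (w * (⟪y, x⟫ : ℝ)) * (⟪y, x⟫ : ℝ)))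
    (Metric.ball_mem_nhds w₀ one_pos) (Eventually.of_forall hmeas) ?_ ?_ ?_ hbound
    ?_).2.differentiableAt
  · refine hbound.mono' (hmeas w₀) ?_
    filter_upwards [hC] with x hx
    refine le_trans ?_ (hle hx)
    rw [norm_mul]
    gcongr
    refine (hbd hself _).trans (Real.exp_le_exp.2 ?_)
    gcongr
    linarith
  · exact hi.aestronglyMeasurable.mul (by fun_prop)
  · filter_upwards [hC] with x hx w hmem
    refine le_trans ?_ (hle hx)
    rw [norm_mul, norm_mul, add_mul, Real.exp_add, one_mul]
    gcongr
    · exact hbd hmem _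
    · rw [Complex.norm_real, Real.norm_eq_abs]
      linarith [Real.add_one_le_exp |⟪y, x⟫|]
  · refine Eventually.of_forall fun x w _ => ?_
    have h1 : HasDerivAt (fun w : ℂ => w * ((⟪y, x⟫ : ℝ) : ℂ)) ((⟪y, x⟫ : ℝ) : ℂ) w := by
      simpa using (hasDerivAt_id w).mul_const ((⟪y, x⟫ : ℝ) : ℂ)
    exact h1.cexp.const_mul (h x)

theorem norm_integral_mul_cexp_le {h : V → ℂ} {a C : ℝ} (ha : 0 < a)
    (hC : ∀ᵐ x : V, ‖h x‖ ≤ C * Real.exp (-a * ‖x‖ ^ 2)) (y : V) (w : ℂ) :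
    ‖∫ x : V, h x * cexp (w * (⟪y, x⟫ : ℝ))‖ ≤
      C * (Real.pi / a) ^ (Module.finrank ℝ V / 2 : ℝ) *
        Real.exp (w.re ^ 2 * ‖y‖ ^ 2 / (4 * a)) := by
  calc _ ≤ ∫ x : V, C * Real.exp (-a * ‖x‖ ^ 2 + w.re * ⟪y, x⟫) := by
        refine norm_integral_le_of_norm_le
          ((integrable_rexp_neg_mul_sq_norm_add ha _ y).const_mul C) ?_
        filter_upwards [hC] with x hx
        rw [norm_mul, Complex.norm_exp, Real.exp_add, ← mul_assoc]
        rw [Complex.re_mul_ofReal]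
        gcongr
    _ = _ := by
      rw [integral_const_mul, integral_rexp_neg_mul_sq_norm_add ha, mul_assoc]

/-- Injectivity of the Fourier transform on `L¹`: the Fourier transform is self-adjoint and maps
the Schwartz space onto itself, so `h` pairs to zero with every test function. -/
theorem ae_eq_zero_of_fourier_eq_zero {h : V → ℂ} (hi : Integrable h) (h0 : ∀ y, 𝓕 h y = 0) :
    ∀ᵐ x, h x = 0 := by
  refine ae_eq_zero_of_integral_contDiff_smul_eq_zero hi.locallyIntegrable fun g hg hgs => ?_
  have hgs' : HasCompactSupport fun x => (g x : ℂ) := hgs.comp_left Complex.ofReal_zero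
  let φ : SchwartzMap V ℂ := hgs'.toSchwartzMap (Complex.ofRealCLM.contDiff.comp hg)
  have hφ : 𝓕 ((𝓕⁻ φ : SchwartzMap V ℂ) : V → ℂ) = φ := by
    rw [← SchwartzMap.fourier_coe, FourierTransform.fourier_fourierInv_eq]
  have key : ∫ ξ, 𝓕 ((𝓕⁻ φ : SchwartzMap V ℂ) : V → ℂ) ξ • h ξ =
      ∫ x, (𝓕⁻ φ : SchwartzMap V ℂ) x • 𝓕 h x := by
    simpa using! VectorFourier.integral_fourierIntegral_smul_eq_flip (L := innerₗ V)
      Real.continuous_fourierChar continuous_inner (𝓕⁻ φ : SchwartzMap V ℂ).integrable hi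
  rw [hφ] at key
  simp only [h0, smul_zero, integral_zero] at key
  refine Eq.trans (integral_congr_ae (Eventually.of_forall fun x => ?_)) key
  exact (Complex.real_smul (x := g x) (z := h x))

/-- On each line `ℝ y` the function `w ↦ 𝓕 h (w y) exp (β ‖y‖² w²)` is entire, bounded for real
`w`, and of Gaussian growth in `Re w` only; hence it is constant. -/
theorem fourier_eq_of_gaussian_decay {h : V → ℂ} (hi : Integrable h) {α β C C' : ℝ} (hα : 0 < α)
    (hβ : 0 < β) (hαβ : α * β = Real.pi ^ 2)
    (hC : ∀ᵐ x : V, ‖h x‖ ≤ C * Real.exp (-α * ‖x‖ ^ 2))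
    (hC' : ∀ y : V, ‖𝓕 h y‖ ≤ C' * Real.exp (-β * ‖y‖ ^ 2)) (y : V) :
    𝓕 h y = 𝓕 h 0 * cexp (-β * ‖y‖ ^ 2) := by
  let Φ : ℂ → ℂ := fun w => ∫ x : V, h x * cexp (w * (⟪y, x⟫ : ℝ))
  have hΦ (t : ℝ) : Φ (-2 * Real.pi * I * t) = 𝓕 h (t • y) := by
    rw [Real.fourier_eq']
    refine integral_congr_ae (Eventually.of_forall fun x => ?_)
    simp only [smul_eq_mul, inner_smul_right, real_inner_comm x y]
    rw [mul_comm]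
    congr 2
    push_cast
    ring
  let G : ℂ → ℂ := fun w => Φ (-2 * Real.pi * I * w) * cexp (β * ‖y‖ ^ 2 * w ^ 2)
  have hG : Differentiable ℂ G := by
    have h1 : Differentiable ℂ fun w : ℂ => Φ (-2 * Real.pi * I * w) :=
      (differentiable_integral_mul_cexp hi hα hC y).comp (by fun_prop)
    exact h1.mul (by fun_prop)
  have hGr (t : ℝ) : G t = 𝓕 h (t • y) * cexp (β * ‖y‖ ^ 2 * t ^ 2) := by simp only [G, hΦ]
  have hnorm (w : ℂ) : ‖cexp (β * ‖y‖ ^ 2 * w ^ 2)‖ =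
      Real.exp (β * ‖y‖ ^ 2 * (w.re ^ 2 - w.im ^ 2)) := by
    rw [Complex.norm_exp]
    congr 1
    have : ((β : ℂ) * ‖y‖ ^ 2 * w ^ 2) = ((β * ‖y‖ ^ 2 : ℝ) : ℂ) * w ^ 2 := by push_cast; ring
    rw [this, Complex.re_ofReal_mul, sq w, Complex.mul_re]
    ring
  have hconst := apply_eq_apply_zero_of_gaussian_growth (M := C') hG
    (b := β * ‖y‖ ^ 2) (C := C * (Real.pi / α) ^ (Module.finrank ℝ V / 2 : ℝ))
    (by positivity) (fun w => ?_) (fun t => ?_) 1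
  · have h1 := hGr 1
    have h0 := hGr 0
    simp only [Complex.ofReal_one, Complex.ofReal_zero, one_smul, zero_smul] at h1 h0
    rw [h1, h0] at hconst
    simp only [one_pow, mul_one, ne_eq, OfNat.ofNat_ne_zero, not_false_eq_true, zero_pow, mul_zero,
      Complex.exp_zero] at hconst
    rw [← hconst, mul_assoc, ← Complex.exp_add]
    simp
  · simp only [G]
    rw [norm_mul, hnorm]
    have h1 := norm_integral_mul_cexp_le hα hC y (-2 * Real.pi * I * w)
    have hre : (-2 * Real.pi * I * w).re = 2 * Real.pi * w.im := by
      simp [Complex.mul_re, Complex.mul_im]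
    -- `αβ = π²` is what makes the two Gaussian factors in `Im w` cancel
    have he : (2 * Real.pi * w.im) ^ 2 * ‖y‖ ^ 2 / (4 * α) = β * ‖y‖ ^ 2 * w.im ^ 2 := by
      rw [div_eq_iff (by positivity)]
      linear_combination (-4 * w.im ^ 2 * ‖y‖ ^ 2) * hαβ
    rw [hre, he] at h1
    calc _ ≤ (C * (Real.pi / α) ^ (Module.finrank ℝ V / 2 : ℝ) *
            Real.exp (β * ‖y‖ ^ 2 * w.im ^ 2)) *
            Real.exp (β * ‖y‖ ^ 2 * (w.re ^ 2 - w.im ^ 2)) := by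
          gcongr
      _ = _ := by
        rw [mul_assoc, ← Real.exp_add]
        ring_nf
  · rw [hGr, norm_mul, hnorm]
    calc _ ≤ C' * Real.exp (-β * ‖t • y‖ ^ 2) *
          Real.exp (β * ‖y‖ ^ 2 * ((t : ℂ).re ^ 2 - (t : ℂ).im ^ 2)) := by
          gcongr
          exact hC' _
      _ = C' := by
        rw [mul_assoc, ← Real.exp_add, norm_smul, mul_pow, Real.norm_eq_abs, sq_abs]
        simp only [Complex.ofReal_re, Complex.ofReal_im]
        ring_nf
        simp

/-- Hardy's uncertainty principle for complex-valued functions, in the critical case. -/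
theorem exists_ae_eq_gaussian_of_fourier_decay {h : V → ℂ} (hi : Integrable h) {α β C C' : ℝ}
    (hα : 0 < α) (hβ : 0 < β) (hαβ : α * β = Real.pi ^ 2)
    (hC : ∀ᵐ x : V, ‖h x‖ ≤ C * Real.exp (-α * ‖x‖ ^ 2))
    (hC' : ∀ y : V, ‖𝓕 h y‖ ≤ C' * Real.exp (-β * ‖y‖ ^ 2)) :
    ∃ c : ℂ, ∀ᵐ x : V, h x = c * (Real.exp (-α * ‖x‖ ^ 2) : ℝ) := by
  have hα' : 0 < (α : ℂ).re := by simpa using hα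
  set g : V → ℂ := fun x => cexp (-α * ‖x‖ ^ 2) with hg
  set D : ℂ := (Real.pi / α) ^ (Module.finrank ℝ V / 2 : ℂ)
  have hgi : Integrable g := by
    simpa [hg] using GaussianFourier.integrable_cexp_neg_mul_sq_norm_add hα' 0 (0 : V)
  have hD : D ≠ 0 := by
    have : (Real.pi / α : ℂ) ≠ 0 :=
      div_ne_zero (by simp) (by simpa using hα.ne')
    simp [D, Complex.cpow_eq_zero_iff, this]
  have hβα : (-(Real.pi : ℂ) ^ 2 / α) = -β := by
    have : (α : ℂ) ≠ 0 := by simpa using hα.ne'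
    rw [div_eq_iff this, ← Complex.ofReal_pow, ← hαβ]
    push_cast
    ring
  have hFg (y : V) : 𝓕 g y = D * cexp (-β * ‖y‖ ^ 2) := by
    rw [hg, fourier_gaussian_innerProductSpace hα', ← hβα]
    congr 2
    ring
  refine ⟨𝓕 h 0 / D, ?_⟩
  have hsub : ∀ y, 𝓕 (fun x => h x - 𝓕 h 0 / D * g x) y = 0 := by
    intro y
    have h1 : 𝓕 (fun x => h x - 𝓕 h 0 / D * g x) y = 𝓕 h y - 𝓕 h 0 / D * 𝓕 g y := by
      simp only [Real.fourier_eq]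
      rw [← integral_const_mul, ← integral_sub]
      · refine integral_congr_ae (Eventually.of_forall fun x => ?_)
        simp only [smul_sub, mul_smul_comm]
      · exact (Real.fourierIntegral_convergent_iff y).2 hi
      · exact ((Real.fourierIntegral_convergent_iff y).2 hgi).const_mul _
    rw [h1, hFg, fourier_eq_of_gaussian_decay hi hα hβ hαβ hC hC' y]
    field_simp
    ring
  filter_upwards [ae_eq_zero_of_fourier_eq_zero (hi.sub (hgi.const_mul _)) hsub] with x hx
  rw [sub_eq_zero.1 hx, hg]
  push_cast
  rfl

end ComplexHardy

/-! ### Splitting the two-sided transform into two complex Fourier transforms -/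

section Split

open Complex Filter FourierTransform RealInnerProductSpace

/-- The coordinate `z` of `q = z (1 + k) + w (1 - k)`, with `z, w ∈ ℝ + ℝ i`. The plane
`ℂ (1 + k)` consists of the quaternions with `i q j = q`. -/
noncomputable def splitPlus : ℍ[ℝ] →L[ℝ] ℂ :=
  LinearMap.toContinuousLinearMap
    { toFun := fun q => ⟨(q.re + q.imK) / 2, (q.imI - q.imJ) / 2⟩
      map_add' := fun p q => by apply Complex.ext <;> simp <;> ring
      map_smul' := fun c q => by apply Complex.ext <;> simp <;> ring }

/-- The coordinate `w` of `q = z (1 + k) + w (1 - k)`, with `z, w ∈ ℝ + ℝ i`. The plane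
`ℂ (1 - k)` consists of the quaternions with `i q j = -q`. -/
noncomputable def splitMinus : ℍ[ℝ] →L[ℝ] ℂ :=
  LinearMap.toContinuousLinearMap
    { toFun := fun q => ⟨(q.re - q.imK) / 2, (q.imI + q.imJ) / 2⟩
      map_add' := fun p q => by apply Complex.ext <;> simp <;> ring
      map_smul' := fun c q => by apply Complex.ext <;> simp <;> ring }

theorem splitPlus_apply (q : ℍ[ℝ]) :
    splitPlus q = ⟨(q.re + q.imK) / 2, (q.imI - q.imJ) / 2⟩ := rfl

theorem splitMinus_apply (q : ℍ[ℝ]) :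
    splitMinus q = ⟨(q.re - q.imK) / 2, (q.imI + q.imJ) / 2⟩ := rfl

theorem norm_sq_eq_split (q : ℍ[ℝ]) : ‖q‖ ^ 2 = 2 * (‖splitPlus q‖ ^ 2 + ‖splitMinus q‖ ^ 2) := by
  rw [sq ‖q‖, ← Quaternion.normSq_eq_norm_mul_self, Quaternion.normSq_def',
    ← Complex.normSq_eq_norm_sq, ← Complex.normSq_eq_norm_sq, splitPlus_apply, splitMinus_apply, Complex.normSq_mk,
    Complex.normSq_mk]
  ring

theorem norm_splitPlus_le (q : ℍ[ℝ]) : ‖splitPlus q‖ ≤ ‖q‖ :=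
  le_of_sq_le_sq (by nlinarith [norm_sq_eq_split q]) (norm_nonneg _)

theorem norm_splitMinus_le (q : ℍ[ℝ]) : ‖splitMinus q‖ ≤ ‖q‖ :=
  le_of_sq_le_sq (by nlinarith [norm_sq_eq_split q]) (norm_nonneg _)

theorem norm_le_split (q : ℍ[ℝ]) : ‖q‖ ≤ 2 * (‖splitPlus q‖ + ‖splitMinus q‖) := by
  refine le_of_sq_le_sq ?_ (by positivity)
  nlinarith [norm_sq_eq_split q, mul_nonneg (norm_nonneg (splitPlus q)) (norm_nonneg (splitMinus q))]

/-- De Moivre's formula for a purely imaginary unit quaternion. -/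
theorem Quaternion.exp_smul_of_imaginary_unit {u : ℍ[ℝ]} (hre : u.re = 0) (hu : ‖u‖ = 1) (t : ℝ) :
    NormedSpace.exp (t • u) = (Real.cos t : ℍ[ℝ]) + Real.sin t • u := by
  rw [Quaternion.exp_of_re_eq_zero _ (by simp [hre]), norm_smul, hu, mul_one, Real.norm_eq_abs,
    Real.cos_abs, smul_smul]
  congr 2
  -- at `t = 0` the quotient is `sin 0 / 0 = 0`, which agrees with `sin 0`
  rcases eq_or_ne t 0 with rfl | ht
  · simp
  · rcases abs_choice t with h | h
    · rw [h]
      field_simp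
    · rw [h, Real.sin_neg]
      field_simp

@[simp] theorem quatI_re : quatI.re = 0 := rfl
@[simp] theorem quatI_imI : quatI.imI = 1 := rfl
@[simp] theorem quatI_imJ : quatI.imJ = 0 := rfl
@[simp] theorem quatI_imK : quatI.imK = 0 := rfl
@[simp] theorem quatJ_re : quatJ.re = 0 := rfl
@[simp] theorem quatJ_imI : quatJ.imI = 0 := rfl
@[simp] theorem quatJ_imJ : quatJ.imJ = 1 := rfl
@[simp] theorem quatJ_imK : quatJ.imK = 0 := rfl

theorem norm_quatI : ‖quatI‖ = 1 := by
  rw [← sq_eq_sq₀ (norm_nonneg _) zero_le_one, sq, ← Quaternion.normSq_eq_norm_mul_self,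
    Quaternion.normSq_def']
  simp

theorem norm_quatJ : ‖quatJ‖ = 1 := by
  rw [← sq_eq_sq₀ (norm_nonneg _) zero_le_one, sq, ← Quaternion.normSq_eq_norm_mul_self,
    Quaternion.normSq_def']
  simp

/-- On `ℂ (1 + k)`, right multiplication by `j` is left multiplication by `-i`. -/
theorem splitPlus_exp_mul_mul_exp (s t : ℝ) (q : ℍ[ℝ]) :
    splitPlus (NormedSpace.exp (s • quatI) * q * NormedSpace.exp (t • quatJ)) =
      cexp ((s - t : ℝ) * I) * splitPlus q := by
  rw [Quaternion.exp_smul_of_imaginary_unit quatI_re norm_quatI,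
    Quaternion.exp_smul_of_imaginary_unit quatJ_re norm_quatJ, splitPlus_apply, splitPlus_apply]
  apply Complex.ext
  · rw [Complex.mul_re, Complex.exp_ofReal_mul_I_re, Complex.exp_ofReal_mul_I_im, Real.cos_sub,
      Real.sin_sub]
    simp
    ring
  · rw [Complex.mul_im, Complex.exp_ofReal_mul_I_re, Complex.exp_ofReal_mul_I_im, Real.cos_sub,
      Real.sin_sub]
    simp
    ring

/-- On `ℂ (1 - k)`, right multiplication by `j` is left multiplication by `i`. -/
theorem splitMinus_exp_mul_mul_exp (s t : ℝ) (q : ℍ[ℝ]) :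
    splitMinus (NormedSpace.exp (s • quatI) * q * NormedSpace.exp (t • quatJ)) =
      cexp ((s + t : ℝ) * I) * splitMinus q := by
  rw [Quaternion.exp_smul_of_imaginary_unit quatI_re norm_quatI,
    Quaternion.exp_smul_of_imaginary_unit quatJ_re norm_quatJ, splitMinus_apply, splitMinus_apply]
  apply Complex.ext
  · rw [Complex.mul_re, Complex.exp_ofReal_mul_I_re, Complex.exp_ofReal_mul_I_im, Real.cos_add,
      Real.sin_add]
    simp
    ring
  · rw [Complex.mul_im, Complex.exp_ofReal_mul_I_re, Complex.exp_ofReal_mul_I_im, Real.cos_add,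
      Real.sin_add]
    simp
    ring

theorem integrable_qft_integrand {f : EuclideanSpace ℝ (Fin 2) → ℍ[ℝ]} (hf : Integrable f)
    (ξ : EuclideanSpace ℝ (Fin 2)) :
    Integrable fun x : EuclideanSpace ℝ (Fin 2) =>
      NormedSpace.exp (-(2 * Real.pi * ξ 0 * x 0) • quatI) * f x *
        NormedSpace.exp (-(2 * Real.pi * ξ 1 * x 1) • quatJ) := by
  let +nondep : NormedAlgebra ℚ ℍ[ℝ] := .restrictScalars ℚ ℝ ℍ[ℝ]
  have hexp : Continuous (NormedSpace.exp : ℍ[ℝ] → ℍ[ℝ]) := NormedSpace.exp_continuous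
  refine hf.norm.mono' ((AEStronglyMeasurable.mul ?_ hf.aestronglyMeasurable).mul ?_) ?_
  · exact (hexp.comp (by fun_prop)).aestronglyMeasurable
  · exact (hexp.comp (by fun_prop)).aestronglyMeasurable
  · refine Eventually.of_forall fun x => le_of_eq ?_
    rw [norm_mul, norm_mul, Quaternion.norm_exp, Quaternion.norm_exp]
    simp

/-- The reflection `(y₁, y₂) ↦ (y₁, -y₂)` of the plane. -/
def reflectSnd (y : EuclideanSpace ℝ (Fin 2)) : EuclideanSpace ℝ (Fin 2) := !₂[y 0, -y 1]

theorem norm_reflectSnd (y : EuclideanSpace ℝ (Fin 2)) : ‖reflectSnd y‖ = ‖y‖ := by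
  simp [reflectSnd, EuclideanSpace.norm_eq, Fin.sum_univ_two]

theorem reflectSnd_reflectSnd (y : EuclideanSpace ℝ (Fin 2)) : reflectSnd (reflectSnd y) = y := by
  ext i
  fin_cases i <;> simp [reflectSnd]

theorem splitPlus_qft {f : EuclideanSpace ℝ (Fin 2) → ℍ[ℝ]} (hf : Integrable f)
    (y : EuclideanSpace ℝ (Fin 2)) :
    splitPlus (qft f y) = 𝓕 (fun x => splitPlus (f x)) (reflectSnd y) := by
  rw [qft, ← ContinuousLinearMap.integral_comp_comm _ (integrable_qft_integrand hf y),
    Real.fourier_eq']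
  refine integral_congr_ae (Eventually.of_forall fun x => ?_)
  simp only [splitPlus_exp_mul_mul_exp, smul_eq_mul]
  congr 4
  simp [PiLp.inner_apply, Fin.sum_univ_two, reflectSnd]
  ring

theorem splitMinus_qft {f : EuclideanSpace ℝ (Fin 2) → ℍ[ℝ]} (hf : Integrable f)
    (y : EuclideanSpace ℝ (Fin 2)) :
    splitMinus (qft f y) = 𝓕 (fun x => splitMinus (f x)) y := by
  rw [qft, ← ContinuousLinearMap.integral_comp_comm _ (integrable_qft_integrand hf y),
    Real.fourier_eq']
  refine integral_congr_ae (Eventually.of_forall fun x => ?_)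
  simp only [splitMinus_exp_mul_mul_exp, smul_eq_mul]
  congr 4
  simp [PiLp.inner_apply, Fin.sum_univ_two]
  ring

end Split

/-! ### Hardy's theorem for the quaternion Fourier transform -/

section QuaternionHardy

open Filter FourierTransform

theorem exists_ae_eq_gaussian_of_qft_decay {α β : ℝ} (hα : 0 < α) (hβ : 0 < β)
    (hαβ : α * β = Real.pi ^ 2) {f : EuclideanSpace ℝ (Fin 2) → ℍ[ℝ]} (hf : Integrable f)
    {C C' : ℝ} (hC : ∀ᵐ x, ‖f x‖ ≤ C * Real.exp (-α * ‖x‖ ^ 2))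
    (hC' : ∀ y, ‖qft f y‖ ≤ C' * Real.exp (-β * ‖y‖ ^ 2)) :
    ∃ q : ℍ[ℝ], ∀ᵐ x, f x = q * (Real.exp (-α * ‖x‖ ^ 2) : ℍ[ℝ]) := by
  obtain ⟨c, hc⟩ := exists_ae_eq_gaussian_of_fourier_decay
    (splitPlus.integrable_comp hf) hα hβ hαβ
    (hC.mono fun x hx => (norm_splitPlus_le _).trans hx)
    (fun y => by
      rw [← reflectSnd_reflectSnd y, ← splitPlus_qft hf, norm_reflectSnd]
      exact (norm_splitPlus_le _).trans (by simpa [norm_reflectSnd] using hC' (reflectSnd y)))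
  obtain ⟨d, hd⟩ := exists_ae_eq_gaussian_of_fourier_decay
    (splitMinus.integrable_comp hf) hα hβ hαβ
    (hC.mono fun x hx => (norm_splitMinus_le _).trans hx)
    (fun y => by
      rw [← splitMinus_qft hf]
      exact (norm_splitMinus_le _).trans (hC' y))
  let q : ℍ[ℝ] := ⟨c.re + d.re, c.im + d.im, d.im - c.im, c.re - d.re⟩
  have q0 : q.re = c.re + d.re := rfl
  have q1 : q.imI = c.im + d.im := rfl
  have q2 : q.imJ = d.im - c.im := rfl
  have q3 : q.imK = c.re - d.re := rfl
  refine ⟨q, ?_⟩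
  filter_upwards [hc, hd] with x h1 h2
  rw [splitPlus_apply] at h1
  rw [splitMinus_apply] at h2
  have h1r := congrArg Complex.re h1
  have h1i := congrArg Complex.im h1
  have h2r := congrArg Complex.re h2
  have h2i := congrArg Complex.im h2
  simp only [Complex.re_mul_ofReal, Complex.im_mul_ofReal] at h1r h1i h2r h2i
  rw [Quaternion.mul_coe_eq_smul]
  ext
  · rw [Quaternion.re_smul, q0, smul_eq_mul]; linarith
  · rw [Quaternion.imI_smul, q1, smul_eq_mul]; linarith
  · rw [Quaternion.imJ_smul, q2, smul_eq_mul]; linarith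
  · rw [Quaternion.imK_smul, q3, smul_eq_mul]; linarith

/-- In the supercritical case, the critical one applied with `π² / β < α` makes `f` a multiple of
a Gaussian that is too wide for the decay of `f`, unless the factor vanishes. -/
theorem ae_eq_zero_of_qft_decay {α β : ℝ} (hβ : 0 < β)
    (hαβ : Real.pi ^ 2 < α * β) {f : EuclideanSpace ℝ (Fin 2) → ℍ[ℝ]} (hf : Integrable f)
    {C C' : ℝ} (hC0 : 0 ≤ C) (hC : ∀ᵐ x, ‖f x‖ ≤ C * Real.exp (-α * ‖x‖ ^ 2))
    (hC' : ∀ y, ‖qft f y‖ ≤ C' * Real.exp (-β * ‖y‖ ^ 2)) :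
    ∀ᵐ x, f x = 0 := by
  set γ : ℝ := Real.pi ^ 2 / β with hγ
  have hγ0 : 0 < γ := by positivity
  have hγα : γ < α := (div_lt_iff₀ hβ).2 hαβ
  obtain ⟨q, hq⟩ := exists_ae_eq_gaussian_of_qft_decay hγ0 hβ (by rw [hγ]; field_simp) hf
    (C := C) (hC.mono fun x hx => hx.trans (by gcongr)) hC'
  have hall : ∀ x : EuclideanSpace ℝ (Fin 2),
      ‖q‖ * Real.exp (-γ * ‖x‖ ^ 2) ≤ C * Real.exp (-α * ‖x‖ ^ 2) := by
    have hae : ∀ᵐ x : EuclideanSpace ℝ (Fin 2),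
        ‖q‖ * Real.exp (-γ * ‖x‖ ^ 2) ≤ C * Real.exp (-α * ‖x‖ ^ 2) := by
      filter_upwards [hq, hC] with x h1 h2
      rwa [h1, norm_mul, Quaternion.norm_coe, Real.norm_of_nonneg (Real.exp_nonneg _)] at h2
    -- the estimate holds on a dense set and is a closed condition
    have hcl : IsClosed {x : EuclideanSpace ℝ (Fin 2) |
        ‖q‖ * Real.exp (-γ * ‖x‖ ^ 2) ≤ C * Real.exp (-α * ‖x‖ ^ 2)} :=
      isClosed_le (by fun_prop) (by fun_prop)
    have hd := MeasureTheory.Measure.dense_of_ae hae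
    intro x
    have := hcl.closure_eq ▸ hd.closure_eq
    exact (Set.ext_iff.1 this x).2 trivial
  have hlim : Tendsto (fun t : ℝ => C * Real.exp (-((α - γ) * t ^ 2))) atTop (nhds 0) := by
    have h1 : Tendsto (fun t : ℝ => (α - γ) * t ^ 2) atTop atTop :=
      (tendsto_pow_atTop two_ne_zero).const_mul_atTop (by linarith)
    simpa using (Real.tendsto_exp_neg_atTop_nhds_zero.comp h1).const_mul C
  have hq0 : ‖q‖ ≤ 0 := by
    refine ge_of_tendsto hlim (Eventually.of_forall fun t => ?_)
    have h := hall (EuclideanSpace.single 0 t)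
    rw [PiLp.norm_single, Real.norm_eq_abs, sq_abs] at h
    have he : -((α - γ) * t ^ 2) + -γ * t ^ 2 = -α * t ^ 2 := by ring
    rwa [← mul_le_mul_iff_of_pos_right (Real.exp_pos (-γ * t ^ 2)), mul_assoc, ← Real.exp_add, he]
  filter_upwards [hq] with x hx
  rw [hx, norm_le_zero_iff.1 hq0, zero_mul]

end QuaternionHardy

/-! ### Gaussians in the subcritical case -/

section Subcritical

open Filter FourierTransform

/-- The real Gaussian `exp (-γ |x|²)` as a quaternion-valued function on the plane. -/
noncomputable def quatGaussian (γ : ℝ) (x : EuclideanSpace ℝ (Fin 2)) : ℍ[ℝ] :=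
  (Real.exp (-γ * ‖x‖ ^ 2) : ℝ)

theorem norm_quatGaussian (γ : ℝ) (x : EuclideanSpace ℝ (Fin 2)) :
    ‖quatGaussian γ x‖ = Real.exp (-γ * ‖x‖ ^ 2) := by
  rw [quatGaussian, Quaternion.norm_coe, Real.norm_of_nonneg (Real.exp_nonneg _)]

theorem continuous_quatGaussian (γ : ℝ) : Continuous (quatGaussian γ) :=
  Quaternion.continuous_coe.comp (by fun_prop)

theorem integrable_quatGaussian {γ : ℝ} (hγ : 0 < γ) : Integrable (quatGaussian γ) := by
  have h := integrable_rexp_neg_mul_sq_norm_add hγ 0 (0 : EuclideanSpace ℝ (Fin 2))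
  simp only [zero_mul, add_zero] at h
  exact h.mono' (continuous_quatGaussian γ).aestronglyMeasurable
    (Eventually.of_forall fun x => (norm_quatGaussian γ x).le)

theorem splitPlus_coe (r : ℝ) : splitPlus (r : ℍ[ℝ]) = 2⁻¹ * (r : ℂ) := by
  rw [splitPlus_apply]
  apply Complex.ext <;> simp [div_eq_inv_mul]

theorem splitMinus_coe (r : ℝ) : splitMinus (r : ℍ[ℝ]) = 2⁻¹ * (r : ℂ) := by
  rw [splitMinus_apply]
  apply Complex.ext <;> simp [div_eq_inv_mul]

theorem norm_fourier_half_gaussian {γ : ℝ} (hγ : 0 < γ) (y : EuclideanSpace ℝ (Fin 2)) :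
    ‖𝓕 (fun x : EuclideanSpace ℝ (Fin 2) =>
      2⁻¹ * ((Real.exp (-γ * ‖x‖ ^ 2) : ℝ) : ℂ)) y‖ =
      2⁻¹ * (Real.pi / γ) * Real.exp (-(Real.pi ^ 2 / γ) * ‖y‖ ^ 2) := by
  have h := fourier_gaussian_innerProductSpace (V := EuclideanSpace ℝ (Fin 2)) (b := (γ : ℂ))
    (by simpa using hγ) y
  have h2 : 𝓕 (fun x : EuclideanSpace ℝ (Fin 2) =>
      2⁻¹ * ((Real.exp (-γ * ‖x‖ ^ 2) : ℝ) : ℂ)) y =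
      2⁻¹ * 𝓕 (fun x : EuclideanSpace ℝ (Fin 2) => Complex.exp (-γ * ‖x‖ ^ 2)) y := by
    simp only [Real.fourier_eq]
    rw [← integral_const_mul]
    refine integral_congr_ae (Eventually.of_forall fun x => ?_)
    simp [mul_smul_comm]
  have he : (-(Real.pi : ℂ) ^ 2 * ‖y‖ ^ 2 / γ) =
      ((-(Real.pi ^ 2 / γ) * ‖y‖ ^ 2 : ℝ) : ℂ) := by
    push_cast
    ring
  rw [h2, h, he, ← Complex.ofReal_exp, norm_mul, norm_mul, Complex.norm_real,
    Real.norm_of_nonneg (Real.exp_nonneg _), ← mul_assoc]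
  congr 2
  · simp
  · simp [abs_of_pos Real.pi_pos, abs_of_pos hγ]

theorem norm_qft_quatGaussian_le {γ : ℝ} (hγ : 0 < γ) (y : EuclideanSpace ℝ (Fin 2)) :
    ‖qft (quatGaussian γ) y‖ ≤
      2 * (Real.pi / γ) * Real.exp (-(Real.pi ^ 2 / γ) * ‖y‖ ^ 2) := by
  refine (norm_le_split _).trans (le_of_eq ?_)
  rw [splitPlus_qft (integrable_quatGaussian hγ), splitMinus_qft (integrable_quatGaussian hγ)]
  simp only [quatGaussian, splitPlus_coe, splitMinus_coe, norm_fourier_half_gaussian hγ,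
    norm_reflectSnd]
  ring

/-- Dedekind's independence of characters, for the characters `t ↦ exp (-γ t)` of the additive
monoid `[0, ∞)`. -/
theorem linearIndependent_exp_neg_mul {ι : Type*} {γ : ι → ℝ} (hγ : Function.Injective γ) :
    LinearIndependent ℝ fun (i : ι) (t : NNReal) => Real.exp (-γ i * t) := by
  let χ : ι → Multiplicative NNReal →* ℝ := fun i =>
    { toFun := fun t => Real.exp (-γ i * (t.toAdd : ℝ))
      map_one' := by simp
      map_mul' := fun s t => by
        rw [← Real.exp_add, toAdd_mul, NNReal.coe_add, mul_add] }
  have hχ : Function.Injective χ := fun i j hij => by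
    have := DFunLike.congr_fun hij (Multiplicative.ofAdd 1)
    exact hγ (by simpa [χ] using this)
  exact (linearIndependent_monoidHom (Multiplicative NNReal) ℝ).comp χ hχ

theorem eq_zero_of_sum_exp_smul_eq_zero {E ι : Type*} [NormedAddCommGroup E]
    [InnerProductSpace ℝ E] {γ : ι → ℝ} (hγ : Function.Injective γ) (s : Finset ι) (q : ι → E)
    (h : ∀ t : ℝ, 0 ≤ t → ∑ i ∈ s, Real.exp (-γ i * t) • q i = 0) : ∀ i ∈ s, q i = 0 := by
  intro i hi
  have hlin := linearIndependent_iff'.1 (linearIndependent_exp_neg_mul hγ) s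
    (fun j => inner ℝ (q i) (q j)) ?_ i hi
  -- pairing the relation with `q i` reduces it to one with real coefficients
  · exact inner_self_eq_zero.1 hlin
  · ext t
    have := congrArg (inner ℝ (q i)) (h t t.2)
    simpa [inner_sum, inner_smul_right, mul_comm] using this

/-- Gaussians of distinct widths are linearly independent in `L¹`, over any ring of scalars that
commutes with the reals and acts freely on `1`; this covers `ℍ` acting from either side. -/
theorem linearIndependent_toL1_quatGaussian {R : Type*} [NormedRing R] [Module R ℍ[ℝ]]
    [IsBoundedSMul R ℍ[ℝ]] [SMulCommClass ℝ R ℍ[ℝ]] (hR : ∀ r : R, r • (1 : ℍ[ℝ]) = 0 → r = 0)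
    {ι : Type*} {γ : ι → ℝ} (hγ : Function.Injective γ)
    (hi : ∀ n, Integrable (quatGaussian (γ n))) :
    LinearIndependent R fun n => (hi n).toL1 (quatGaussian (γ n)) := by
  refine linearIndependent_iff'.2 fun s c hc n hn => hR _ ?_
  refine eq_zero_of_sum_exp_smul_eq_zero hγ s (fun i => c i • (1 : ℍ[ℝ])) (fun t ht => ?_) n hn
  have hsum (x : EuclideanSpace ℝ (Fin 2)) : ∑ i ∈ s, c i • quatGaussian (γ i) x =
      ∑ i ∈ s, Real.exp (-γ i * ‖x‖ ^ 2) • c i • (1 : ℍ[ℝ]) := by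
    refine Finset.sum_congr rfl fun i _ => ?_
    rw [smul_comm, quatGaussian, ← Quaternion.coe_mul_eq_smul, mul_one]
  have hae : (fun x => ∑ i ∈ s, c i • quatGaussian (γ i) x) =ᵐ[volume] fun _ => 0 := by
    have h0 := Lp.coeFn_fun_finsetSum s fun i => c i • (hi i).toL1 (quatGaussian (γ i))
    rw [hc] at h0
    have h1 : ∀ᵐ x, ∀ i ∈ s, (c i • (hi i).toL1 (quatGaussian (γ i)) :
        EuclideanSpace ℝ (Fin 2) →₁[volume] ℍ[ℝ]) x = c i • quatGaussian (γ i) x := by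
      refine (eventually_all_finset s).2 fun i _ => ?_
      filter_upwards [Lp.coeFn_smul (c i) ((hi i).toL1 (quatGaussian (γ i))),
        (hi i).coeFn_toL1] with x h2 h3
      rw [h2, Pi.smul_apply, h3]
    filter_upwards [h0, h1, Lp.coeFn_zero ℍ[ℝ] 1 (volume : Measure (EuclideanSpace ℝ (Fin 2)))]
      with x h2 h3 h4
    rw [← Finset.sum_congr rfl h3, ← h2, h4, Pi.zero_apply]
  have heq := Continuous.ae_eq_iff_eq volume (continuous_finsetSum s fun i _ =>
    (continuous_quatGaussian (γ i)).const_smul (c i)) continuous_const |>.1 hae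
  -- points of norm `√t` realize every `t ≥ 0` as a value of `‖x‖²`
  have := congrFun heq (EuclideanSpace.single 0 (Real.sqrt t))
  simp only [Pi.smul_apply] at this
  rwa [hsum, PiLp.norm_single, Real.norm_eq_abs, sq_abs, Real.sq_sqrt ht] at this

end Subcritical

/-! ### The three regimes -/

theorem mainTheorem2 (α β : ℝ) (hα : 0 < α) (hβ : 0 < β) :
    (Real.pi ^ 2 < α * β →
      ∀ f : EuclideanSpace ℝ (Fin 2) → ℍ[ℝ], Integrable f volume →
        (∃ C : ℝ, 0 < C ∧ ∀ᵐ x ∂volume, ‖f x‖ < C * Real.exp (-α * ‖x‖ ^ 2)) →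
        (∃ C' : ℝ, 0 < C' ∧ ∀ y, ‖qft f y‖ < C' * Real.exp (-β * ‖y‖ ^ 2)) →
        ∀ᵐ x ∂volume, f x = 0) ∧
    (α * β = Real.pi ^ 2 →
      ∀ f : EuclideanSpace ℝ (Fin 2) → ℍ[ℝ], Integrable f volume →
        (∃ C : ℝ, 0 < C ∧ ∀ᵐ x ∂volume, ‖f x‖ < C * Real.exp (-α * ‖x‖ ^ 2)) →
        (∃ C' : ℝ, 0 < C' ∧ ∀ y, ‖qft f y‖ < C' * Real.exp (-β * ‖y‖ ^ 2)) →
        ∃ q : ℍ[ℝ], ∀ᵐ x ∂volume, f x = q * (Real.exp (-α * ‖x‖ ^ 2) : ℍ[ℝ])) ∧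
    (α * β < Real.pi ^ 2 →
      ∃ (g : ℕ → EuclideanSpace ℝ (Fin 2) → ℍ[ℝ]) (hg : ∀ n, Integrable (g n) volume),
        (∀ n,
          (∃ C : ℝ, 0 < C ∧ ∀ x, ‖g n x‖ < C * Real.exp (-α * ‖x‖ ^ 2)) ∧
          (∃ C' : ℝ, 0 < C' ∧ ∀ y, ‖qft (g n) y‖ < C' * Real.exp (-β * ‖y‖ ^ 2))) ∧
        LinearIndependent ℍ[ℝ] (fun n => (hg n).toL1 (g n)) ∧
        LinearIndependent ℍ[ℝ]ᵐᵒᵖ (fun n => (hg n).toL1 (g n))) := by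
  refine ⟨fun hαβ f hf ⟨C, hC0, hC⟩ ⟨C', _, hC'⟩ => ?_,
    fun hαβ f hf ⟨C, _, hC⟩ ⟨C', _, hC'⟩ => ?_, fun hαβ => ?_⟩
  · exact ae_eq_zero_of_qft_decay hβ hαβ hf hC0.le (hC.mono fun x hx => hx.le)
      fun y => (hC' y).le
  · exact exists_ae_eq_gaussian_of_qft_decay hα hβ hαβ hf (hC.mono fun x hx => hx.le)
      fun y => (hC' y).le
  -- the exponents admissible for both decay conditions form the interval `[α, π² / β]`
  have hd : 0 < Real.pi ^ 2 / β - α := sub_pos.2 ((lt_div_iff₀ hβ).2 hαβ)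
  let γ : ℕ → ℝ := fun n => α + (Real.pi ^ 2 / β - α) / (n + 1)
  have hγinj : Function.Injective γ := fun m n hmn => by
    have h1 : (Real.pi ^ 2 / β - α) / ((m : ℝ) + 1) = (Real.pi ^ 2 / β - α) / ((n : ℝ) + 1) :=
      add_left_cancel hmn
    rw [div_eq_div_iff (by positivity) (by positivity)] at h1
    exact_mod_cast (add_right_cancel (mul_left_cancel₀ hd.ne' h1)).symm
  have hαγ (n : ℕ) : α ≤ γ n := le_add_of_nonneg_right (by positivity)
  have hγ0 (n : ℕ) : 0 < γ n := hα.trans_le (hαγ n)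
  have hγβ (n : ℕ) : β ≤ Real.pi ^ 2 / γ n := by
    rw [le_div_comm₀ hβ (hγ0 n)]
    have : (Real.pi ^ 2 / β - α) / ((n : ℝ) + 1) ≤ Real.pi ^ 2 / β - α :=
      div_le_self hd.le (by linarith [(n.cast_nonneg : (0 : ℝ) ≤ n)])
    simp only [γ]
    linarith
  refine ⟨fun n => quatGaussian (γ n), fun n => integrable_quatGaussian (hγ0 n),
    fun n => ⟨⟨2, two_pos, fun x => ?_⟩, 2 * (Real.pi / γ n) + 1, ?_, fun y => ?_⟩, ?_, ?_⟩
  · rw [norm_quatGaussian]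
    have h1 : Real.exp (-γ n * ‖x‖ ^ 2) ≤ Real.exp (-α * ‖x‖ ^ 2) := by
      gcongr
      exact hαγ n
    linarith [Real.exp_pos (-α * ‖x‖ ^ 2)]
  · have := hγ0 n
    positivity
  · have := hγ0 n
    calc _ ≤ 2 * (Real.pi / γ n) * Real.exp (-(Real.pi ^ 2 / γ n) * ‖y‖ ^ 2) :=
          norm_qft_quatGaussian_le (hγ0 n) y
      _ ≤ 2 * (Real.pi / γ n) * Real.exp (-β * ‖y‖ ^ 2) := by
          gcongr
          exact hγβ n
      _ < _ := by
          gcongr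
          linarith
  · exact linearIndependent_toL1_quatGaussian (R := ℍ[ℝ]) (fun r hr => by simpa using hr) hγinj _
  · exact linearIndependent_toL1_quatGaussian (R := ℍ[ℝ]ᵐᵒᵖ) (fun r hr => by simpa using hr)
      hγinj _
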